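/- **Model.** A *fully-parallel circuit* with $n$ inputs and $k$ outputs is laid out in the plane on a grid of unit squares (Thompson model). Each computational node occupies one square. Each wire joins two nodes and runs along side-adjacent squares that are free of other nodes; each side of a square is crossed by at most one wire (at most once), and wires may share a square only where they cross at a right angle. The nodes operate synchronously: in each clock cycle every wire carries one bit in each direction, and every node updates its memory and determines the bits it sends from its own memory and the bits arriving on its wires. The $n$ input symbols are injected at the start into $n$ distinct input nodes, and the $k$ output bits are read at the end from $k$ distinct output nodes. The area $A$ is the number of squares occupied by nodes and wires, $T$ is the number of clock cycles, and the energy is $E=AT$. Fix $\epsilon\in(0,1)$. A *decoding scheme* is a sequence of codes with block lengths $n_1<n_2<\cdots$, numbers of bits $k(n_1),k(n_2),\dots$ and encoding functions $\{0,1\}^{k(n)}\to\{0,1\}^{n}$, each with a fully-parallel decoding circuit with $n$ inputs and $k(n)$ outputs. Let $P_{\mathrm e}(n)$ be the block error probability of the decoder of block length $n$ when $k(n)$ independent fair bits are encoded, sent through $n$ uses of the binary erasure channel with erasure probability $\epsilon$, and the $n$ channel outputs (each a bit or an erasure) are the inputs of the decoder. The scheme is *polynomially-low-error* if for some $t>0$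 one has $P_{\mathrm e}(n)<n^{-t}$ for all sufficiently large block lengths $n$ of the scheme, and the limit $R=\lim_{n\to\infty}k(n)/n$ exists and is positive. **Statement.** Every polynomially-low-error decoding scheme has energy $E(n)\ge\Omega\left(n\sqrt{\ln n}\right)$ as $n\to\infty$ along the block lengths of the scheme. If a scheme attains this bound, i.e. $E(n)=\Theta\left(n\sqrt{\ln n}\right)$, then $T(n)\ge\Omega\left(\sqrt{\ln n}\right)$. -/

import Mathlib

open Filter Topology Asymptotics

/-- The grid of unit squares that tile the plane (a square is named by its integer coordinates);
two squares are adjacent when they share a side. -/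
def squareGrid : SimpleGraph (ℤ × ℤ) where
  Adj p q := |p.1 - q.1| + |p.2 - q.2| = 1
  symm := ⟨fun p q h => by rwa [abs_sub_comm q.1, abs_sub_comm q.2]⟩
  loopless := ⟨fun p h => by simp at h⟩

/-- The walk `p` goes straight through its `i`-th square (used for `0 < i < p.length`). -/
def IsStraightAt {a b : ℤ × ℤ} (p : squareGrid.Walk a b) (i : ℕ) : Prop :=
  p.getVert (i + 1) - p.getVert i = p.getVert i - p.getVert (i - 1)

/-- The planar layout of a circuit in the Thompson model, with wires of unit width.
Each node occupies one square. A wire joins two nodes and runs through squares that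
are free of nodes. A side of a square is crossed by at most one wire, so a node has at most four
wire ends; wires share a square only where they cross at a right angle, both running straight. -/
structure ThompsonLayout where
  numNodes : ℕ
  numWires : ℕ
  /-- the square that a node occupies -/
  place : Fin numNodes ↪ ℤ × ℤ
  /-- the node at the end `false`, respectively `true`, of a wire -/
  tip : Fin numWires → Bool → Fin numNodes
  /-- the squares that a wire visits, the squares of the two nodes included -/
  route : (w : Fin numWires) → squareGrid.Walk (place (tip w false)) (place (tip w true))
  route_not_nil : ∀ w, ¬ (route w).Nil
  route_isTrail : ∀ w, (route w).IsTrail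
  route_disjoint : ∀ w w', w ≠ w' → (route w).edges.Disjoint (route w').edges
  route_avoids_nodes : ∀ w i, 0 < i → i < (route w).length →
    (route w).getVert i ∉ Set.range place
  right_angle_crossing : ∀ w i w' j, 0 < i → i < (route w).length →
    0 < j → j < (route w').length → (route w).getVert i = (route w').getVert j →
    (w = w' ∧ i = j) ∨ (IsStraightAt (route w) i ∧ IsStraightAt (route w') j)

namespace ThompsonLayout

/-- The squares occupied by nodes and wires. -/
def occupied (L : ThompsonLayout) : Set (ℤ × ℤ) :=
  Set.range L.place ∪ {c | ∃ w, c ∈ (L.route w).support}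

/-- The circuit area: the number of occupied unit squares. -/
noncomputable def area (L : ThompsonLayout) : ℕ := L.occupied.ncard

end ThompsonLayout

/-- A fully-parallel circuit with `n` inputs and `k` outputs: a Thompson layout with nodes that
operate synchronously. Each input symbol (a channel output: a bit, or `none` for an erasure) is
injected at the start into an input node of its own, and each output bit appears at the end in
an output node of its own. In a clock cycle, each wire carries one bit in each direction.
A node sends, and updates its state, as a function of its own state and of the bits that
arrive on the wires attached to it. -/
structure FullyParallelCircuit (n k : ℕ) extends ThompsonLayout where
  /-- contents of the memory of a node -/
  State : Type
  input : Fin n ↪ Fin numNodes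
  output : Fin k ↪ Fin numNodes
  /-- initial state of a node that is not an input node -/
  start : Fin numNodes → State
  /-- initial state of an input node, given the injected symbol -/
  load : Fin n → Option Bool → State
  /-- the bit that the node at end `b` of wire `w` sends into this wire -/
  send : (w : Fin numWires) → (b : Bool) → State → Bool
  /-- the new state of a node, given its state and the bits arriving at its wire ends -/
  update : (v : Fin numNodes) → State →
    ({e : Fin numWires × Bool // tip e.1 e.2 = v} → Bool) → State
  /-- the output bit that an output node presents at the end -/
  read : Fin k → State → Bool
  /-- the number of clock cycles of the computation -/
  cycles : ℕ

namespace FullyParallelCircuit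

variable {n k : ℕ} (C : FullyParallelCircuit n k)

/-- The states of the nodes before the first clock cycle, on input `y`. -/
noncomputable def initial (y : Fin n → Option Bool) : Fin C.numNodes → C.State :=
  Function.extend C.input (fun i => C.load i (y i)) C.start

/-- One clock cycle: the bit arriving at an end of a wire is the one sent from its other end. -/
def cycle (s : Fin C.numNodes → C.State) : Fin C.numNodes → C.State := fun v =>
  C.update v (s v) (fun e => C.send e.1.1 (!e.1.2) (s (C.tip e.1.1 (!e.1.2))))

/-- The function computed by the circuit. -/
noncomputable def compute (y : Fin n → Option Bool) : Fin k → Bool := fun j =>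
  C.read j ((C.cycle^[C.cycles] (C.initial y)) (C.output j))

/-- The energy `A T` of the computation. -/
noncomputable def energy : ℝ := (C.area : ℝ) * (C.cycles : ℝ)

end FullyParallelCircuit

/-- Transition probabilities of the binary erasure channel with erasure probability `ε`
(`none` is the erasure symbol). -/
noncomputable def binaryErasureChannel (ε : ℝ) (x : Bool) : Option Bool → ℝ
  | none => ε
  | some b => if b = x then 1 - ε else 0

/-- Block error probability: `k` independent fair bits are encoded by `enc`, sent through `n`
independent uses of the binary erasure channel, and estimated by `dec` from the received word. -/
noncomputable def blockErrorProbability (ε : ℝ) {n k : ℕ}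
    (enc : (Fin k → Bool) → (Fin n → Bool)) (dec : (Fin n → Option Bool) → (Fin k → Bool)) : ℝ :=
  ∑ x : Fin k → Bool, (1 / 2 : ℝ) ^ k *
    ∑ y : Fin n → Option Bool,
      (∏ i, binaryErasureChannel ε (enc x i) (y i)) * (if dec y = x then 0 else 1)

/-- A fully-parallel decoding scheme: an infinite sequence of codes with increasing block lengths,
each with a fully-parallel decoding circuit. -/
structure DecodingScheme where
  blockLength : ℕ → ℕ
  blockLength_strictMono : StrictMono blockLength
  bitsDecoded : ℕ → ℕ
  encoder : (m : ℕ) → (Fin (bitsDecoded m) → Bool) → (Fin (blockLength m) → Bool)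
  decoder : (m : ℕ) → FullyParallelCircuit (blockLength m) (bitsDecoded m)

namespace DecodingScheme

variable (D : DecodingScheme)

/-- The block error probability of the `m`-th decoder of the scheme. -/
noncomputable def errorProbability (ε : ℝ) (m : ℕ) : ℝ :=
  blockErrorProbability ε (D.encoder m) (D.decoder m).compute

/-- `D` is an `f(n)`-decoding scheme. -/
def IsSchemeFor (ε : ℝ) (f : ℕ → ℝ) : Prop :=
  ∀ᶠ m in atTop, D.errorProbability ε m < f (D.blockLength m)

/-- The asymptotic rate exists and equals `R`. -/
def HasRate (R : ℝ) : Prop :=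
  Tendsto (fun m => (D.bitsDecoded m : ℝ) / (D.blockLength m : ℝ)) atTop (𝓝 R)

/-- Polynomially-low-error decoding schemes for the erasure channel. -/
def IsPolynomiallyLowError (ε : ℝ) : Prop :=
  (∃ t : ℝ, 0 < t ∧ D.IsSchemeFor ε (fun n => 1 / (n : ℝ) ^ t)) ∧
    ∃ R : ℝ, 0 < R ∧ D.HasRate R

/-- The energy of the `m`-th decoder of the scheme. -/
noncomputable def energy (m : ℕ) : ℝ := (D.decoder m).energy

/-- The number of clock cycles of the `m`-th decoder of the scheme. -/
def cycles (m : ℕ) : ℕ := (D.decoder m).cycles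

end DecodingScheme

/-!
If the inputs of a set of nodes, at most `m` in number, are all erased, an event of probability at
least `ε ^ m`, then the outputs read there depend only on the bits that enter the set over its
boundary wires during the `T` clock cycles. If these bits were fewer than the outputs, at most half
of the messages could be decoded, so a block error probability below `ε ^ m / 2` forces the number
of outputs to be at most `T` times the number of boundary wires, for every such set.

To divide the circuit with few boundary wires, scan the plane in vertical strips of width `S`, row
by row within each strip, and start a new class after every `m` inputs. Averaged over the position
of the strips, at most `A / S` unit sides lie between different strips; averaged over the first cut,
the `n / m` cuts within the strips separate about `S + 1` unit sides each. All `k` outputs must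
therefore cross `O(A / S + n S / m)` sides in `T` cycles, and the best `S` gives
`k ^ 2 * m = O(n * A * T ^ 2)`. An error probability of `exp (-t φ(n))` allows `m` of order `φ(n)`,
whence `A * T ^ 2 = Ω(n φ(n))` at a positive rate. Multiplying by `A ≥ n` bounds the energy `A * T`,
and dividing by `A * T = O(n √φ(n))` bounds `T`.
-/

open scoped Finset

theorem sum_range_add_ediv (a : ℤ) {m : ℕ} (hm : 0 < m) :
    ∑ i ∈ Finset.range m, (a + i) / (m : ℤ) = a := by
  have hm' : (m : ℤ) ≠ 0 := by positivity
  have hstep : ∀ b : ℤ, ∑ i ∈ Finset.range m, (b + 1 + i) / (m : ℤ) =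
      ∑ i ∈ Finset.range m, (b + i) / (m : ℤ) + 1 := by
    intro b
    have hlast := Finset.sum_range_succ (fun i : ℕ => (b + i) / (m : ℤ)) m
    have hfirst := Finset.sum_range_succ' (fun i : ℕ => (b + i) / (m : ℤ)) m
    have hshift : ∀ i : ℕ, b + ((i + 1 : ℕ) : ℤ) = b + 1 + i := fun i => by push_cast; ring
    simp only [hshift, Nat.cast_zero, add_zero] at hfirst
    rw [Int.add_ediv_of_dvd_right dvd_rfl, Int.ediv_self hm'] at hlast
    omega
  have hzero : ∑ i ∈ Finset.range m, (0 + (i : ℤ)) / (m : ℤ) = 0 :=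
    Finset.sum_eq_zero fun i hi => by
      rw [zero_add]
      exact Int.ediv_eq_zero_of_lt (by positivity) (by exact_mod_cast Finset.mem_range.1 hi)
  induction a using Int.induction_on with
  | zero => exact hzero
  | succ a ih => rw [hstep, ih]
  | pred a ih =>
    have h := hstep (-a - 1)
    rw [sub_add_cancel] at h
    omega

theorem card_filter_add_ediv_ne_le {a b : ℤ} (hab : a ≤ b) {m : ℕ} (hm : 0 < m) :
    (#{i ∈ Finset.range m | (a + (i : ℕ)) / m ≠ (b + i) / m} : ℤ) ≤ b - a := by
  calc (#{i ∈ Finset.range m | (a + (i : ℕ)) / m ≠ (b + i) / m} : ℤ)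
      = ∑ i ∈ Finset.range m, if (a + i) / m ≠ (b + i) / m then 1 else 0 :=
        Finset.natCast_card_filter _ _
    _ ≤ ∑ i ∈ Finset.range m, ((b + (i : ℤ)) / (m : ℤ) - (a + i) / m) := by
        refine Finset.sum_le_sum fun i _ => ?_
        have hmono : (a + (i : ℤ)) / (m : ℤ) ≤ (b + i) / m :=
          Int.ediv_le_ediv (by positivity) (by omega)
        split_ifs <;> omega
    _ = b - a := by
        rw [Finset.sum_sub_distrib, sum_range_add_ediv b hm, sum_range_add_ediv a hm]

theorem exists_mul_card_filter_add_ediv_ne_le {ι : Type*} (E : Finset ι) {u v : ι → ℤ}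
    (huv : ∀ e ∈ E, u e ≤ v e) {m : ℕ} (hm : 0 < m) :
    ∃ i : ℕ, m * (#{e ∈ E | (u e + i) / m ≠ (v e + i) / m} : ℤ) ≤ ∑ e ∈ E, (v e - u e) := by
  have hsum : ∑ i ∈ Finset.range m, m * (#{e ∈ E | (u e + i) / m ≠ (v e + i) / m} : ℤ) ≤
      ∑ _i ∈ Finset.range m, ∑ e ∈ E, (v e - u e) := by
    calc ∑ i ∈ Finset.range m, m * (#{e ∈ E | (u e + i) / m ≠ (v e + i) / m} : ℤ)
        = m * ∑ e ∈ E, (#{i ∈ Finset.range m | (u e + (i : ℕ)) / m ≠ (v e + i) / m} : ℤ) := by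
          rw [← Finset.mul_sum]
          exact_mod_cast congrArg ((m : ℤ) * ·) (congrArg Nat.cast
            (Finset.sum_card_bipartiteAbove_eq_sum_card_bipartiteBelow
              fun (i : ℕ) e => (u e + (i : ℤ)) / m ≠ (v e + i) / m))
      _ ≤ m * ∑ e ∈ E, (v e - u e) := by
          gcongr with e he
          exact card_filter_add_ediv_ne_le (huv e he) hm
      _ = ∑ _i ∈ Finset.range m, ∑ e ∈ E, (v e - u e) := by
          rw [Finset.sum_const, Finset.card_range, nsmul_eq_mul]
  obtain ⟨i, -, hi⟩ := Finset.exists_le_of_sum_le (Finset.nonempty_range_iff.2 hm.ne') hsum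
  exact ⟨i, hi⟩

theorem card_filter_add_ediv_eq_le {ι : Type*} {Q : Finset ι} {u : ι → ℤ} (hu : Set.InjOn u Q)
    (o a : ℤ) {m : ℕ} (hm : 0 < m) : #{q ∈ Q | (u q + o) / m = a} ≤ m := by
  calc #{q ∈ Q | (u q + o) / m = a} ≤ #(Finset.Ico (a * m - o) (a * m - o + m)) := by
        refine Finset.card_le_card_of_injOn u (fun q hq => ?_) (hu.mono (Finset.filter_subset _ _))
        have h := (Finset.mem_filter.1 hq).2
        rw [Int.ediv_eq_iff_of_pos (by positivity)] at h
        rw [Finset.coe_Ico, Set.mem_Ico]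
        omega
    _ = m := by simp

section Rank

variable {α β : Type*} [LinearOrder α] (key : β → α) (Q : Finset β)

/-- The rank of `p` with respect to `Q`: the number of elements of `Q` whose key is smaller. It is
an integer because ranks are subtracted and shifted before they are cut into intervals. -/
def keyRank (p : β) : ℤ := #{q ∈ Q | key q < key p}

theorem keyRank_sub_keyRank {p p' : β} (h : key p ≤ key p') :
    keyRank key Q p' - keyRank key Q p = #{q ∈ Q | key p ≤ key q ∧ key q < key p'} := by
  have hsplit := Finset.card_filter_add_card_filter_not (s := {q ∈ Q | key q < key p'})
    (fun q => key q < key p)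
  simp only [Finset.filter_filter, not_lt] at hsplit
  have hlow : {q ∈ Q | key q < key p' ∧ key q < key p} = {q ∈ Q | key q < key p} :=
    Finset.filter_congr fun q _ => and_iff_right_of_imp fun hq => hq.trans_le h
  rw [hlow] at hsplit
  simp only [keyRank, and_comm (a := key p ≤ _)]
  omega

variable {key}

theorem injOn_keyRank (hkey : Set.InjOn key Q) : Set.InjOn (keyRank key Q) Q := by
  have hlt : ∀ p ∈ Q, ∀ p', key p < key p' → keyRank key Q p < keyRank key Q p' := by
    intro p hp p' h
    have hpos : 0 < #{q ∈ Q | key p ≤ key q ∧ key q < key p'} :=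
      Finset.card_pos.2 ⟨p, by simp [hp, h]⟩
    have := keyRank_sub_keyRank key Q h.le
    omega
  intro p hp p' hp' heq
  rcases lt_trichotomy (key p) (key p') with h | h | h
  · exact absurd heq (hlt p hp p' h).ne
  · exact hkey hp hp' h
  · exact absurd heq (hlt p' hp' p h).ne'

theorem exists_partition_mul_card_filter_ne_le (hkey : Set.InjOn key Q) {E : Finset (β × β)}
    (hE : ∀ e ∈ E, key e.1 ≤ key e.2) {m : ℕ} (hm : 0 < m) :
    ∃ f : β → ℤ, (∀ a, #{q ∈ Q | f q = a} ≤ m) ∧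
      m * #{e ∈ E | f e.1 ≠ f e.2} ≤
        ∑ q ∈ Q, #{e ∈ E | key e.1 ≤ key q ∧ key q < key e.2} := by
  have hmono : ∀ e ∈ E, keyRank key Q e.1 ≤ keyRank key Q e.2 := fun e he => by
    have := keyRank_sub_keyRank key Q (hE e he)
    omega
  obtain ⟨i, hi⟩ := exists_mul_card_filter_add_ediv_ne_le E hmono hm
  refine ⟨fun p => (keyRank key Q p + i) / m,
    fun a => card_filter_add_ediv_eq_le (injOn_keyRank Q hkey) i a hm, ?_⟩
  rw [Finset.sum_congr rfl fun e he => keyRank_sub_keyRank key Q (hE e he)] at hi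
  calc m * #{e ∈ E | (keyRank key Q e.1 + i) / m ≠ (keyRank key Q e.2 + i) / m}
      ≤ ∑ e ∈ E, #{q ∈ Q | key e.1 ≤ key q ∧ key q < key e.2} := by exact_mod_cast hi
    _ = ∑ q ∈ Q, #{e ∈ E | key e.1 ≤ key q ∧ key q < key e.2} :=
        Finset.sum_card_bipartiteAbove_eq_sum_card_bipartiteBelow
          fun (e : β × β) q => key e.1 ≤ key q ∧ key q < key e.2

end Rank

section Plane

/-- The sides shared by two squares of `A`. A side is encoded as the pair of the squares on its two
sides, the left or the lower one first. -/
def unitSides (A : Finset (ℤ × ℤ)) : Finset ((ℤ × ℤ) × (ℤ × ℤ)) :=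
  {e ∈ A ×ˢ A | e.2 = (e.1.1 + 1, e.1.2) ∨ e.2 = (e.1.1, e.1.2 + 1)}

/-- The index of the vertical strip that contains the square `p`, when the plane is cut into strips
of width `S` with offset `o`. -/
def strip (S : ℕ) (o : ℤ) (p : ℤ × ℤ) : ℤ := (p.1 + o) / S

/-- The key by which the squares are scanned: strip after strip, row by row within a strip, and from
left to right within a row. -/
def scanKey (S : ℕ) (o : ℤ) (p : ℤ × ℤ) : ℤ ×ₗ ℤ ×ₗ ℤ :=
  toLex (strip S o p, toLex (p.2, p.1))

theorem scanKey_injective (S : ℕ) (o : ℤ) : Function.Injective (scanKey S o) := by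
  intro p q h
  simp only [scanKey, EmbeddingLike.apply_eq_iff_eq, Prod.mk.injEq] at h
  exact Prod.ext h.2.2 h.2.1

theorem exists_shift_mul_card_strip_ne_le (A : Finset (ℤ × ℤ)) {S : ℕ} (hS : 0 < S) :
    ∃ o : ℤ, S * #{e ∈ unitSides A | strip S o e.1 ≠ strip S o e.2} ≤ #A := by
  have hmono : ∀ e ∈ unitSides A, e.1.1 ≤ e.2.1 := by
    intro e he
    rcases (Finset.mem_filter.1 he).2 with h | h <;> simp [h]
  obtain ⟨o, ho⟩ := exists_mul_card_filter_add_ediv_ne_le (unitSides A) hmono hS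
  refine ⟨o, ?_⟩
  have hright : ∑ e ∈ unitSides A, (e.2.1 - e.1.1) ≤ #A := by
    calc ∑ e ∈ unitSides A, (e.2.1 - e.1.1)
        = ∑ e ∈ unitSides A, if e.2 = (e.1.1 + 1, e.1.2) then 1 else 0 := by
          refine Finset.sum_congr rfl fun e he => ?_
          rcases (Finset.mem_filter.1 he).2 with h | h <;> simp [h]
      _ = #{e ∈ unitSides A | e.2 = (e.1.1 + 1, e.1.2)} := (Finset.natCast_card_filter _ _).symm
      _ ≤ #A := by
          norm_cast
          refine Finset.card_le_card_of_injOn Prod.fst (fun e he => ?_) fun e he e' he' h => ?_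
          · exact (Finset.mem_product.1
              (Finset.mem_filter.1 (Finset.mem_filter.1 he).1).1).1
          · have he := (Finset.mem_filter.1 he).2
            have he' := (Finset.mem_filter.1 he').2
            exact Prod.ext h (by rw [he, he', h])
  exact_mod_cast ho.trans hright

theorem card_unitSides_around_le (A : Finset (ℤ × ℤ)) {S : ℕ} (hS : 0 < S) (o : ℤ) (q : ℤ × ℤ) :
    #{e ∈ {e ∈ unitSides A | strip S o e.1 = strip S o e.2} |
      scanKey S o e.1 ≤ scanKey S o q ∧ scanKey S o q < scanKey S o e.2} ≤ S + 1 := by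
  set l : ℤ := strip S o q * S - o
  -- These sides form a descending staircase between the squares scanned up to `q` and the later
  -- ones of its strip, so a side is determined by its value of `e.1.1 - e.2.2`.
  calc _ ≤ #(Finset.Ico (l - q.2 - 1) (l - q.2 + S)) := by
        refine Finset.card_le_card_of_injOn (fun e => e.1.1 - e.2.2) ?_ ?_
        · rintro ⟨p, p'⟩ he
          simp only [unitSides, scanKey, Prod.Lex.toLex_le_toLex, Prod.Lex.toLex_lt_toLex,
            Finset.coe_filter, Finset.mem_filter, Set.mem_ofPred_eq] at he
          have hstrip : strip S o p = strip S o q := by omega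
          have hcol := hstrip
          rw [strip, Int.ediv_eq_iff_of_pos (by positivity)] at hcol
          obtain ⟨⟨⟨-, rfl | rfl⟩, _⟩, h⟩ := he
          all_goals
            simp only [Finset.coe_Ico, Set.mem_Ico]
            simp only at h
            omega
        · rintro ⟨⟨x, y⟩, p'⟩ he ⟨⟨x', y'⟩, p''⟩ he' heq
          simp only [unitSides, scanKey, Prod.Lex.toLex_le_toLex, Prod.Lex.toLex_lt_toLex,
            Finset.coe_filter, Finset.mem_filter, Set.mem_ofPred_eq] at he he'
          simp only at heq
          obtain ⟨⟨⟨-, rfl | rfl⟩, _⟩, h⟩ := he <;> obtain ⟨⟨⟨-, rfl | rfl⟩, _⟩, h'⟩ := he' <;>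
          · simp only [Prod.mk.injEq] at *
            omega
    _ = S + 1 := by
        rw [Int.card_Ico]
        omega

theorem exists_partition_mul_card_unitSides_ne_le (Q A : Finset (ℤ × ℤ)) {m S : ℕ} (hm : 0 < m)
    (hS : 0 < S) :
    ∃ f : ℤ × ℤ → ℤ, (∀ a, #{q ∈ Q | f q = a} ≤ m) ∧
      S * m * #{e ∈ unitSides A | f e.1 ≠ f e.2} ≤ m * #A + S * (S + 1) * #Q := by
  obtain ⟨o, ho⟩ := exists_shift_mul_card_strip_ne_le A hS
  set N := {e ∈ unitSides A | strip S o e.1 = strip S o e.2}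
  have hmono : ∀ e ∈ N, scanKey S o e.1 ≤ scanKey S o e.2 := by
    rintro ⟨p, p'⟩ he
    simp only [N, unitSides, Finset.mem_filter] at he
    simp only [scanKey, Prod.Lex.toLex_le_toLex, he.2]
    obtain ⟨⟨-, rfl | rfl⟩, _⟩ := he <;> simp
  obtain ⟨f, hfiber, hcut⟩ :=
    exists_partition_mul_card_filter_ne_le Q (scanKey_injective S o).injOn hmono hm
  have hcutN : m * #{e ∈ N | f e.1 ≠ f e.2} ≤ (S + 1) * #Q := by
    refine hcut.trans ((Finset.sum_le_card_nsmul Q _ (S + 1) fun q _ => ?_).trans_eq ?_)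
    · exact card_unitSides_around_le A hS o q
    · rw [smul_eq_mul, mul_comm]
  refine ⟨f, hfiber, ?_⟩
  calc S * m * #{e ∈ unitSides A | f e.1 ≠ f e.2}
      ≤ S * m * (#{e ∈ unitSides A | strip S o e.1 ≠ strip S o e.2} +
          #{e ∈ N | f e.1 ≠ f e.2}) := by
        gcongr
        refine (Finset.card_le_card fun e he => ?_).trans (Finset.card_union_le _ _)
        simp only [N, Finset.mem_union, Finset.mem_filter] at he ⊢
        tauto
    _ = m * (S * #{e ∈ unitSides A | strip S o e.1 ≠ strip S o e.2}) +
          S * (m * #{e ∈ N | f e.1 ≠ f e.2}) := by ring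
    _ ≤ m * #A + S * ((S + 1) * #Q) := by gcongr
    _ = m * #A + S * (S + 1) * #Q := by ring

end Plane


theorem binaryErasureChannel_nonneg {ε : ℝ} (h0 : 0 ≤ ε) (h1 : ε ≤ 1) (x : Bool)
    (z : Option Bool) : 0 ≤ binaryErasureChannel ε x z := by
  rcases z with _ | b
  · exact h0
  · rw [binaryErasureChannel]
    split_ifs <;> linarith

theorem sum_binaryErasureChannel (ε : ℝ) (x : Bool) : ∑ z, binaryErasureChannel ε x z = 1 := by
  cases x <;> simp [Fintype.sum_option, binaryErasureChannel]

/-- The received words in which all symbols with index in `S` are erased (and possibly others). -/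
def wordsErasedOn {n : ℕ} (S : Finset (Fin n)) : Finset (Fin n → Option Bool) :=
  {y | ∀ i ∈ S, y i = none}

theorem sum_wordsErasedOn_prod_binaryErasureChannel (ε : ℝ) {n : ℕ} (c : Fin n → Bool)
    (S : Finset (Fin n)) :
    ∑ y ∈ wordsErasedOn S, ∏ i, binaryErasureChannel ε (c i) (y i) = ε ^ #S := by
  have hpi : wordsErasedOn S =
      Fintype.piFinset fun i => if i ∈ S then {none} else Finset.univ := by
    ext y
    simp only [wordsErasedOn, Finset.mem_filter_univ, Fintype.mem_piFinset]
    refine forall_congr' fun i => ?_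
    split_ifs with hi <;> simp [hi]
  have hfactor : ∀ i, ∑ z ∈ if i ∈ S then {none} else Finset.univ,
      binaryErasureChannel ε (c i) z = if i ∈ S then ε else 1 := by
    intro i
    split_ifs
    · exact Finset.sum_singleton _ _
    · exact sum_binaryErasureChannel ε (c i)
  rw [hpi, ← Finset.prod_univ_sum, Finset.prod_congr rfl fun i _ => hfactor i]
  simp

section Erasure

variable {ε : ℝ} {n k : ℕ} {dec : (Fin n → Option Bool) → (Fin k → Bool)}

theorem pow_card_le_sum_binaryErasureChannel_of_notMem_image (h0 : 0 ≤ ε) (h1 : ε ≤ 1)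
    (c : Fin n → Bool) {S : Finset (Fin n)} {x : Fin k → Bool}
    (hx : x ∉ (wordsErasedOn S).image dec) :
    ε ^ #S ≤ ∑ y : Fin n → Option Bool,
      (∏ i, binaryErasureChannel ε (c i) (y i)) * (if dec y = x then 0 else 1) := by
  rw [← sum_wordsErasedOn_prod_binaryErasureChannel ε c S]
  calc ∑ y ∈ wordsErasedOn S, ∏ i, binaryErasureChannel ε (c i) (y i)
      = ∑ y ∈ wordsErasedOn S,
          (∏ i, binaryErasureChannel ε (c i) (y i)) * (if dec y = x then 0 else 1) := by
        refine Finset.sum_congr rfl fun y hy => ?_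
        rw [if_neg fun h => hx (Finset.mem_image.2 ⟨y, hy, h⟩), mul_one]
    _ ≤ _ := by
        refine Finset.sum_le_univ_sum_of_nonneg fun y => mul_nonneg ?_ (by split_ifs <;> simp)
        exact Finset.prod_nonneg fun i _ => binaryErasureChannel_nonneg h0 h1 _ _

theorem pow_card_mul_le_blockErrorProbability (h0 : 0 ≤ ε) (h1 : ε ≤ 1)
    (enc : (Fin k → Bool) → (Fin n → Bool)) (S : Finset (Fin n)) :
    ε ^ #S * (1 - #((wordsErasedOn S).image dec) / 2 ^ k) ≤ blockErrorProbability ε enc dec := by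
  have hcompl : (#((wordsErasedOn S).image dec)ᶜ : ℝ) =
      2 ^ k - #((wordsErasedOn S).image dec) := by
    rw [Finset.card_compl, Nat.cast_sub (Finset.card_le_univ _)]
    simp
  calc ε ^ #S * (1 - #((wordsErasedOn S).image dec) / 2 ^ k)
      = ∑ _x ∈ ((wordsErasedOn S).image dec)ᶜ, (1 / 2 : ℝ) ^ k * ε ^ #S := by
        rw [Finset.sum_const, nsmul_eq_mul, hcompl, one_div, inv_pow]
        field_simp
    _ ≤ ∑ x ∈ ((wordsErasedOn S).image dec)ᶜ, (1 / 2 : ℝ) ^ k * ∑ y : Fin n → Option Bool,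
          (∏ i, binaryErasureChannel ε (enc x i) (y i)) * (if dec y = x then 0 else 1) := by
        gcongr with x hx
        exact pow_card_le_sum_binaryErasureChannel_of_notMem_image h0 h1 (enc x)
          (Finset.mem_compl.1 hx)
    _ ≤ blockErrorProbability ε enc dec := by
        refine Finset.sum_le_univ_sum_of_nonneg fun x => mul_nonneg (by positivity) ?_
        refine Finset.sum_nonneg fun y _ => mul_nonneg ?_ (by split_ifs <;> simp)
        exact Finset.prod_nonneg fun i _ => binaryErasureChannel_nonneg h0 h1 _ _

end Erasure

namespace FullyParallelCircuit

variable {n k : ℕ} (C : FullyParallelCircuit n k)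

/-- The input symbols that are injected into the nodes of `S`. -/
def inputsIn (S : Finset (Fin C.numNodes)) : Finset (Fin n) := {i | C.input i ∈ S}

/-- The output bits that are read from the nodes of `S`. -/
def outputsIn (S : Finset (Fin C.numNodes)) : Finset (Fin k) := {j | C.output j ∈ S}

/-- The wire ends through which bits enter the set `S` of nodes from outside. -/
def incoming (S : Finset (Fin C.numNodes)) : Finset (Fin C.numWires × Bool) :=
  {e | C.tip e.1 e.2 ∈ S ∧ C.tip e.1 (!e.2) ∉ S}

/-- The bit that arrives at the wire end `e` in the clock cycle after the first `t` ones. -/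
noncomputable def arriving (y : Fin n → Option Bool) (t : ℕ) (e : Fin C.numWires × Bool) : Bool :=
  C.send e.1 (!e.2) (C.cycle^[t] (C.initial y) (C.tip e.1 (!e.2)))

variable {C} {S : Finset (Fin C.numNodes)} {y y' : Fin n → Option Bool}

theorem initial_eq_of_eq_on_inputsIn (hy : ∀ i ∈ C.inputsIn S, y i = y' i) {v : Fin C.numNodes}
    (hv : v ∈ S) : C.initial y v = C.initial y' v := by
  by_cases hin : ∃ i, C.input i = v
  · obtain ⟨i, rfl⟩ := hin
    rw [initial, initial, C.input.injective.extend_apply, C.input.injective.extend_apply,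
      hy i (by simpa [inputsIn] using hv)]
  · rw [initial, initial, Function.extend_apply' _ _ _ hin, Function.extend_apply' _ _ _ hin]

theorem iterate_cycle_eq_of_arriving_eq (hy : ∀ i ∈ C.inputsIn S, y i = y' i) {t : ℕ}
    (harriving : ∀ r < t, ∀ e ∈ C.incoming S, C.arriving y r e = C.arriving y' r e)
    {v : Fin C.numNodes} (hv : v ∈ S) :
    C.cycle^[t] (C.initial y) v = C.cycle^[t] (C.initial y') v := by
  induction t generalizing v with
  | zero => exact initial_eq_of_eq_on_inputsIn hy hv
  | succ t ih =>
    have hprev : ∀ {u}, u ∈ S → C.cycle^[t] (C.initial y) u = C.cycle^[t] (C.initial y') u :=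
      ih fun r hr => harriving r (hr.trans t.lt_succ_self)
    rw [Function.iterate_succ_apply', Function.iterate_succ_apply', cycle, cycle, hprev hv]
    congr 1
    funext ⟨e, he⟩
    by_cases hsource : C.tip e.1 (!e.2) ∈ S
    · simp only [hprev hsource]
    · exact harriving t t.lt_succ_self e (by simp [incoming, he, hv, hsource])

theorem compute_eq_of_arriving_eq (hy : ∀ i ∈ C.inputsIn S, y i = y' i)
    (harriving : ∀ r < C.cycles, ∀ e ∈ C.incoming S, C.arriving y r e = C.arriving y' r e)
    {j : Fin k} (hj : j ∈ C.outputsIn S) : C.compute y j = C.compute y' j :=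
  congrArg (C.read j) <|
    iterate_cycle_eq_of_arriving_eq hy harriving (by simpa [outputsIn] using hj)

theorem card_image_compute_le (C : FullyParallelCircuit n k) (S : Finset (Fin C.numNodes)) :
    #((wordsErasedOn (C.inputsIn S)).image C.compute) ≤
      2 ^ (C.cycles * #(C.incoming S) + (k - #(C.outputsIn S))) := by
  classical
  calc #((wordsErasedOn (C.inputsIn S)).image C.compute)
      ≤ #(Finset.univ : Finset ((Fin C.cycles → C.incoming S → Bool) ×
          ({j // j ∉ C.outputsIn S} → Bool))) := by
        refine Finset.card_le_card_of_forall_subsingleton (fun x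
          (b : (Fin C.cycles → C.incoming S → Bool) × ({j // j ∉ C.outputsIn S} → Bool)) =>
          ∃ y ∈ wordsErasedOn (C.inputsIn S), C.compute y = x ∧
            (∀ t e, b.1 t e = C.arriving y t e) ∧ ∀ j, b.2 j = x j) (fun x hx => ?_) ?_
        · obtain ⟨y, hy, hyx⟩ := Finset.mem_image.1 hx
          exact ⟨(fun t e => C.arriving y t e, fun j => x j), Finset.mem_univ _, y, hy, hyx,
            fun _ _ => rfl, fun _ => rfl⟩
        · rintro b - x ⟨-, y, hy, rfl, harriving, houtside⟩ x' ⟨-, y', hy', rfl, harriving',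
            houtside'⟩
          funext j
          by_cases hj : j ∈ C.outputsIn S
          · simp only [wordsErasedOn, Finset.mem_filter_univ] at hy hy'
            exact compute_eq_of_arriving_eq (fun i hi => (hy i hi).trans (hy' i hi).symm)
              (fun t ht e he => (harriving ⟨t, ht⟩ ⟨e, he⟩).symm.trans
                (harriving' ⟨t, ht⟩ ⟨e, he⟩)) hj
          · exact (houtside ⟨j, hj⟩).symm.trans (houtside' ⟨j, hj⟩)
    _ = 2 ^ (C.cycles * #(C.incoming S) + (k - #(C.outputsIn S))) := by
        simp [Fintype.card_subtype_compl, ← pow_mul, pow_add, mul_comm]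

theorem card_outputsIn_le {ε : ℝ} (h0 : 0 ≤ ε) (h1 : ε ≤ 1)
    {enc : (Fin k → Bool) → (Fin n → Bool)} {m : ℕ}
    (herr : blockErrorProbability ε enc C.compute < ε ^ m / 2)
    (hS : #(C.inputsIn S) ≤ m) : #(C.outputsIn S) ≤ C.cycles * #(C.incoming S) := by
  by_contra! hlt
  have hhalf : (#((wordsErasedOn (C.inputsIn S)).image C.compute) : ℝ) / 2 ^ k ≤ 1 / 2 := by
    have hout : #(C.outputsIn S) ≤ k := by simpa using (C.outputsIn S).card_le_univ
    have himage : 2 * #((wordsErasedOn (C.inputsIn S)).image C.compute) ≤ 2 ^ k := by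
      calc 2 * #((wordsErasedOn (C.inputsIn S)).image C.compute)
          ≤ 2 * 2 ^ (C.cycles * #(C.incoming S) + (k - #(C.outputsIn S))) := by
            gcongr
            exact C.card_image_compute_le S
        _ ≤ 2 ^ k := by
            rw [← pow_succ']
            exact Nat.pow_le_pow_right two_pos (by omega)
    rw [div_le_div_iff₀ (by positivity) two_pos]
    exact_mod_cast (by omega)
  have : ε ^ m / 2 ≤ blockErrorProbability ε enc C.compute := by
    calc ε ^ m / 2 = ε ^ m * (1 - 1 / 2) := by ring
      _ ≤ ε ^ #(C.inputsIn S) *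
          (1 - #((wordsErasedOn (C.inputsIn S)).image C.compute) / 2 ^ k) := by
          gcongr ?_ * ?_
          · exact pow_le_pow_of_le_one h0 h1 hS
          · linarith
      _ ≤ _ := pow_card_mul_le_blockErrorProbability h0 h1 enc _
  exact this.not_gt herr

/-- The wires that join different classes of the partition of the nodes into the fibers of `f`. -/
def crossingWires {α : Type*} [DecidableEq α] (C : FullyParallelCircuit n k)
    (f : Fin C.numNodes → α) : Finset (Fin C.numWires) :=
  {w | f (C.tip w false) ≠ f (C.tip w true)}

theorem sum_card_incoming_le {α : Type*} [DecidableEq α] (C : FullyParallelCircuit n k)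
    (f : Fin C.numNodes → α) :
    ∑ a ∈ Finset.univ.image f, #(C.incoming {v | f v = a}) ≤ 2 * #(C.crossingWires f) := by
  set X : Finset (Fin C.numWires × Bool) := {e | f (C.tip e.1 e.2) ≠ f (C.tip e.1 (!e.2))}
  calc ∑ a ∈ Finset.univ.image f, #(C.incoming {v | f v = a}) = #X := by
        rw [Finset.card_eq_sum_card_fiberwise (f := fun e => f (C.tip e.1 e.2))
          (t := Finset.univ.image f) (fun e _ => by simp)]
        refine Finset.sum_congr rfl fun a _ => congrArg _ ?_
        ext e
        simp only [incoming, X, Finset.mem_filter]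
        grind
    _ ≤ #(C.crossingWires f ×ˢ (Finset.univ : Finset Bool)) := by
        refine Finset.card_le_card fun ⟨w, b⟩ he => ?_
        cases b <;> simp_all [X, crossingWires, eq_comm]
    _ = 2 * #(C.crossingWires f) := by simp [mul_comm]

theorem outputs_le_mul_card_crossingWires {α : Type*} [DecidableEq α] {ε : ℝ} (h0 : 0 ≤ ε)
    (h1 : ε ≤ 1) {enc : (Fin k → Bool) → (Fin n → Bool)} {m : ℕ}
    (herr : blockErrorProbability ε enc C.compute < ε ^ m / 2) (f : Fin C.numNodes → α)
    (hf : ∀ a, #{i | f (C.input i) = a} ≤ m) : k ≤ 2 * C.cycles * #(C.crossingWires f) := by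
  calc k = #(Finset.univ : Finset (Fin k)) := by simp
    _ = ∑ a ∈ Finset.univ.image f, #(C.outputsIn {v | f v = a}) := by
        rw [Finset.card_eq_sum_card_fiberwise (f := fun j => f (C.output j))
          (t := Finset.univ.image f) (fun j _ => by simp)]
        simp [outputsIn]
    _ ≤ ∑ a ∈ Finset.univ.image f, C.cycles * #(C.incoming {v | f v = a}) :=
        Finset.sum_le_sum fun a _ =>
          card_outputsIn_le h0 h1 herr (by simpa [inputsIn] using hf a)
    _ ≤ C.cycles * (2 * #(C.crossingWires f)) := by
        rw [← Finset.mul_sum]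
        gcongr
        exact C.sum_card_incoming_le f
    _ = 2 * C.cycles * #(C.crossingWires f) := by ring

end FullyParallelCircuit

theorem mem_unitSides_or_swap_mem_unitSides {A : Finset (ℤ × ℤ)} {p q : ℤ × ℤ} (hp : p ∈ A)
    (hq : q ∈ A) (h : squareGrid.Adj p q) : (p, q) ∈ unitSides A ∨ (q, p) ∈ unitSides A := by
  simp only [unitSides, Finset.mem_filter, Finset.mem_product, hp, hq, Prod.ext_iff, true_and]
  have h : |p.1 - q.1| + |p.2 - q.2| = 1 := h
  rcases abs_cases (p.1 - q.1) with h1 | h1 <;> rcases abs_cases (p.2 - q.2) with h2 | h2 <;> omega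

namespace ThompsonLayout

variable (L : ThompsonLayout)

theorem occupied_finite : L.occupied.Finite := by
  have hwires : {c | ∃ w, c ∈ (L.route w).support} = ⋃ w, {c | c ∈ (L.route w).support} := by
    ext
    simp
  rw [occupied, hwires]
  exact (Set.finite_range _).union (Set.finite_iUnion fun w => List.finite_toSet _)

/-- The occupied squares as a finite set, of cardinality `L.area`. -/
noncomputable def squares : Finset (ℤ × ℤ) := L.occupied_finite.toFinset

theorem card_squares : #L.squares = L.area :=
  (Set.ncard_eq_toFinset_card _ L.occupied_finite).symm

theorem numNodes_le_area : L.numNodes ≤ L.area := by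
  calc L.numNodes = (Set.range L.place).ncard := by
        simp [Set.ncard_range_of_injective L.place.injective]
    _ ≤ L.area := Set.ncard_le_ncard Set.subset_union_left L.occupied_finite

theorem card_filter_tip_ne_le {α : Type*} [DecidableEq α] (f : ℤ × ℤ → α) :
    #{w | f (L.place (L.tip w false)) ≠ f (L.place (L.tip w true))} ≤
      #{e ∈ unitSides L.squares | f e.1 ≠ f e.2} := by
  refine Finset.card_le_card_of_forall_subsingleton
    (fun w e => s(e.1, e.2) ∈ (L.route w).edges) (fun w hw => ?_) fun e _ w hw w' hw' => ?_
  · obtain ⟨d, hd, hfst, hsnd⟩ := (L.route w).exists_boundary_dart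
      {x | f x = f (L.place (L.tip w false))} rfl (Ne.symm (Finset.mem_filter.1 hw).2)
    have hne : f d.fst ≠ f d.snd := fun h => hsnd (h.symm.trans hfst)
    have hedge : s(d.fst, d.snd) ∈ (L.route w).edges := List.mem_map_of_mem hd
    have hsquare : ∀ c ∈ (L.route w).support, c ∈ L.squares := fun c hc =>
      L.occupied_finite.mem_toFinset.2 (Or.inr ⟨w, hc⟩)
    rcases mem_unitSides_or_swap_mem_unitSides
      (hsquare _ ((L.route w).fst_mem_support_of_mem_edges hedge))
      (hsquare _ ((L.route w).snd_mem_support_of_mem_edges hedge)) d.adj with h | h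
    · exact ⟨(d.fst, d.snd), Finset.mem_filter.2 ⟨h, hne⟩, hedge⟩
    · exact ⟨(d.snd, d.fst), Finset.mem_filter.2 ⟨h, hne.symm⟩, Sym2.eq_swap ▸ hedge⟩
  · by_contra hne
    exact L.route_disjoint w w' hne hw.2 hw'.2

end ThompsonLayout

namespace FullyParallelCircuit

variable {n k : ℕ} (C : FullyParallelCircuit n k)

theorem inputs_le_area : n ≤ C.area := by
  calc n ≤ C.numNodes := by simpa using Fintype.card_le_of_embedding C.input
    _ ≤ C.area := C.numNodes_le_area

variable {C} {ε : ℝ} {enc : (Fin k → Bool) → (Fin n → Bool)} {m : ℕ}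

theorem outputs_mul_le (h0 : 0 ≤ ε) (h1 : ε ≤ 1)
    (herr : blockErrorProbability ε enc C.compute < ε ^ m / 2) (hm : 0 < m) {S : ℕ} (hS : 0 < S) :
    k * (S * m) ≤ 2 * C.cycles * (m * C.area + S * (S + 1) * n) := by
  set square : Fin n ↪ ℤ × ℤ := C.input.trans C.place
  obtain ⟨f, hfiber, hcut⟩ :=
    exists_partition_mul_card_unitSides_ne_le (Finset.univ.map square) C.squares hm hS
  have hinputs : ∀ a, #{i | f (C.place (C.input i)) = a} ≤ m := fun a => by
    simpa [square, Finset.filter_map, Function.comp_def] using hfiber a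
  calc k * (S * m)
      ≤ 2 * C.cycles * #(C.crossingWires fun v => f (C.place v)) * (S * m) := by
        gcongr
        exact outputs_le_mul_card_crossingWires h0 h1 herr _ hinputs
    _ ≤ 2 * C.cycles * #{e ∈ unitSides C.squares | f e.1 ≠ f e.2} * (S * m) := by
        gcongr
        exact C.card_filter_tip_ne_le f
    _ = 2 * C.cycles * (S * m * #{e ∈ unitSides C.squares | f e.1 ≠ f e.2}) := by ring
    _ ≤ 2 * C.cycles * (m * C.area + S * (S + 1) * n) := by
        gcongr
        simpa [C.card_squares] using hcut

theorem sq_outputs_mul_le (h0 : 0 ≤ ε) (h1 : ε ≤ 1)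
    (herr : blockErrorProbability ε enc C.compute < ε ^ m / 2) (hm : 0 < m) (hn : 0 < n) :
    k ^ 2 * m ≤ 144 * (n * (C.area * C.cycles ^ 2)) := by
  have hA : n ≤ m * C.area := C.inputs_le_area.trans (Nat.le_mul_of_pos_left _ hm)
  -- This strip width balances the two terms of `outputs_mul_le`.
  set S := Nat.sqrt (m * C.area / n)
  have hS : 0 < S := Nat.sqrt_pos.2 (Nat.div_pos hA hn)
  have hlower : S ^ 2 * n ≤ m * C.area := (Nat.le_div_iff_mul_le hn).1 (Nat.sqrt_le' _)
  have hupper : m * C.area ≤ (2 * S) ^ 2 * n := by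
    calc m * C.area ≤ (S + 1) ^ 2 * n := ((Nat.div_lt_iff_lt_mul hn).1 (Nat.lt_succ_sqrt' _)).le
      _ ≤ (2 * S) ^ 2 * n := by
        gcongr
        omega
  have hkS : k * S ≤ 6 * C.cycles * C.area := by
    refine Nat.le_of_mul_le_mul_right ?_ hm
    calc k * S * m = k * (S * m) := mul_assoc _ _ _
      _ ≤ 2 * C.cycles * (m * C.area + S * (S + 1) * n) := outputs_mul_le h0 h1 herr hm hS
      _ ≤ 2 * C.cycles * (m * C.area + S * (S + S) * n) := by gcongr; omega
      _ = 2 * C.cycles * (m * C.area + 2 * (S ^ 2 * n)) := by ring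
      _ ≤ 2 * C.cycles * (m * C.area + 2 * (m * C.area)) := by gcongr
      _ = 6 * C.cycles * C.area * m := by ring
  refine Nat.le_of_mul_le_mul_right ?_ (hn.trans_le C.inputs_le_area)
  calc k ^ 2 * m * C.area = k ^ 2 * (m * C.area) := mul_assoc _ _ _
    _ ≤ k ^ 2 * ((2 * S) ^ 2 * n) := by gcongr
    _ = 4 * n * (k * S) ^ 2 := by ring
    _ ≤ 4 * n * (6 * C.cycles * C.area) ^ 2 := by gcongr
    _ = 144 * (n * (C.area * C.cycles ^ 2)) * C.area := by ring

end FullyParallelCircuit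

theorem exp_neg_le_pow_floor_div_two {ε x : ℝ} (h0 : 0 < ε) (h1 : ε < 1) (hx : 2 ≤ x) :
    Real.exp (-x) ≤ ε ^ ⌊x / (2 * -Real.log ε)⌋₊ / 2 := by
  have hlog : 0 < -Real.log ε := neg_pos.2 (Real.log_neg h0 h1)
  set M := ⌊x / (2 * -Real.log ε)⌋₊
  have hM : M * (2 * -Real.log ε) ≤ x :=
    (le_div_iff₀ (by positivity)).1 (Nat.floor_le (by positivity))
  have hpow : Real.exp (-(x / 2)) ≤ ε ^ M := by
    calc Real.exp (-(x / 2)) ≤ Real.exp (M * Real.log ε) := Real.exp_le_exp.2 (by linarith)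
      _ = ε ^ M := by rw [Real.exp_nat_mul, Real.exp_log h0]
  have hhalf : Real.exp (-(x / 2)) ≤ 1 / 2 := by
    rw [Real.exp_neg, one_div]
    exact inv_anti₀ two_pos (by linarith [Real.add_one_le_exp (x / 2)])
  calc Real.exp (-x) = Real.exp (-(x / 2)) * Real.exp (-(x / 2)) := by
        rw [← Real.exp_add]
        ring_nf
    _ ≤ ε ^ M * (1 / 2) := by gcongr
    _ = ε ^ M / 2 := by ring

theorem FullyParallelCircuit.sq_outputs_mul_le_of_lt_exp_neg {ε x : ℝ} (h0 : 0 < ε) (h1 : ε < 1)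
    (hx : 2 ≤ x) (hxε : 2 * -Real.log ε ≤ x) {n k : ℕ} (hn : 0 < n)
    {C : FullyParallelCircuit n k} {enc : (Fin k → Bool) → (Fin n → Bool)}
    (herr : blockErrorProbability ε enc C.compute < Real.exp (-x)) :
    (k : ℝ) ^ 2 * x ≤ 576 * -Real.log ε * (n * (C.area * (C.cycles : ℝ) ^ 2)) := by
  have hlog : 0 < -Real.log ε := neg_pos.2 (Real.log_neg h0 h1)
  set M := ⌊x / (2 * -Real.log ε)⌋₊
  have hM : 1 ≤ M := Nat.le_floor (by rwa [Nat.cast_one, one_le_div (by positivity)])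
  have hxM : x ≤ 4 * -Real.log ε * M := by
    have hlt : x < (M + 1) * (2 * -Real.log ε) :=
      (div_lt_iff₀ (by positivity)).1 (Nat.lt_floor_add_one _)
    have hM' : (1 : ℝ) ≤ M := by exact_mod_cast hM
    nlinarith
  have hbound : (k : ℝ) ^ 2 * M ≤ 144 * (n * (C.area * (C.cycles : ℝ) ^ 2)) := by
    exact_mod_cast sq_outputs_mul_le h0.le h1.le
      (herr.trans_le (exp_neg_le_pow_floor_div_two h0 h1 hx)) hM hn
  calc (k : ℝ) ^ 2 * x ≤ k ^ 2 * (4 * -Real.log ε * M) := by gcongr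
    _ = 4 * -Real.log ε * (k ^ 2 * M) := by ring
    _ ≤ 4 * -Real.log ε * (144 * (n * (C.area * (C.cycles : ℝ) ^ 2))) := by gcongr
    _ = 576 * -Real.log ε * (n * (C.area * (C.cycles : ℝ) ^ 2)) := by ring

theorem isBigO_of_mul_isBigO_mul_left {α 𝕜 : Type*} [NormedField 𝕜] {l : Filter α}
    {f g h : α → 𝕜} (hf : ∀ᶠ x in l, f x ≠ 0)
    (hfg : (fun x => f x * g x) =O[l] fun x => f x * h x) : g =O[l] h := by
  refine ((isBigO_mul_iff_isBigO_div hf).1 hfg).trans_eventuallyEq ?_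
  filter_upwards [hf] with x hx
  exact mul_div_cancel_left₀ _ hx

namespace DecodingScheme

variable {D : DecodingScheme} {ε t : ℝ} {φ : ℕ → ℝ}

theorem blockLength_mul_isBigO_area_mul_sq_cycles (h0 : 0 < ε) (h1 : ε < 1)
    (hφ : Tendsto φ atTop atTop) (ht : 0 < t)
    (herr : D.IsSchemeFor ε fun n => Real.exp (-(t * φ n)))
    (hrate : (fun m => (D.blockLength m : ℝ)) =O[atTop] fun m => (D.bitsDecoded m : ℝ)) :
    (fun m => D.blockLength m * φ (D.blockLength m)) =O[atTop]
      fun m => (D.decoder m).area * (D.cycles m : ℝ) ^ 2 := by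
  have hlength : Tendsto D.blockLength atTop atTop := D.blockLength_strictMono.tendsto_atTop
  have htφ : Tendsto (fun m => t * φ (D.blockLength m)) atTop atTop :=
    (hφ.comp hlength).const_mul_atTop ht
  have hcircuit : (fun m => (D.bitsDecoded m : ℝ) ^ 2 * (t * φ (D.blockLength m))) =O[atTop]
      fun m => D.blockLength m * ((D.decoder m).area * (D.cycles m : ℝ) ^ 2) := by
    refine IsBigO.of_bound (576 * -Real.log ε) ?_
    filter_upwards [herr, hlength.eventually_gt_atTop 0, htφ.eventually_ge_atTop 2,
      htφ.eventually_ge_atTop (2 * -Real.log ε)] with m herr hn hx hxε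
    rw [Real.norm_of_nonneg (by positivity), Real.norm_of_nonneg (by positivity)]
    exact FullyParallelCircuit.sq_outputs_mul_le_of_lt_exp_neg h0 h1 hx hxε hn herr
  have hsq : (fun m => (D.blockLength m : ℝ) ^ 2 * φ (D.blockLength m)) =O[atTop]
      fun m => (D.bitsDecoded m : ℝ) ^ 2 * (t * φ (D.blockLength m)) :=
    (hrate.pow 2).mul (isBigO_self_const_mul ht.ne' _ _)
  refine isBigO_of_mul_isBigO_mul_left (f := fun m => (D.blockLength m : ℝ)) ?_ ?_
  · filter_upwards [hlength.eventually_ne_atTop 0] with m hm using Nat.cast_ne_zero.2 hm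
  · exact (hsq.trans hcircuit).congr_left fun m => by ring

theorem blockLength_isBigO_area (D : DecodingScheme) :
    (fun m => (D.blockLength m : ℝ)) =O[atTop] fun m => ((D.decoder m).area : ℝ) :=
  IsBigO.of_norm_le fun m => by simpa using (D.decoder m).inputs_le_area

end DecodingScheme

theorem mainTheorem5_general {ε t : ℝ} (h0 : 0 < ε) (h1 : ε < 1) {D : DecodingScheme} {φ : ℕ → ℝ}
    (hφ : Tendsto φ atTop atTop) (ht : 0 < t)
    (herr : D.IsSchemeFor ε fun n => Real.exp (-(t * φ n)))
    (hrate : (fun m => (D.blockLength m : ℝ)) =O[atTop] fun m => (D.bitsDecoded m : ℝ)) :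
    (fun m => D.blockLength m * √(φ (D.blockLength m))) =O[atTop] D.energy ∧
    (D.energy =O[atTop] (fun m => D.blockLength m * √(φ (D.blockLength m))) →
      (fun m => √(φ (D.blockLength m))) =O[atTop] fun m => (D.cycles m : ℝ)) := by
  have hlength : Tendsto D.blockLength atTop atTop := D.blockLength_strictMono.tendsto_atTop
  have hpos : ∀ᶠ m in atTop, 0 < φ (D.blockLength m) := (hφ.comp hlength).eventually_gt_atTop 0
  have hAT := DecodingScheme.blockLength_mul_isBigO_area_mul_sq_cycles h0 h1 hφ ht herr hrate
  constructor
  · refine IsBigO.of_pow two_ne_zero ((D.blockLength_isBigO_area.mul hAT).congr' ?_ ?_)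
    · filter_upwards [hpos] with m hm
      rw [Pi.pow_apply, mul_pow, Real.sq_sqrt hm.le]
      ring
    · exact .of_forall fun m => show _ = ((D.decoder m).area * (D.cycles m : ℝ)) ^ 2 by ring
  · intro henergy
    refine isBigO_of_mul_isBigO_mul_left (f := fun m => D.blockLength m * √(φ (D.blockLength m)))
      ?_ ((hAT.trans ((henergy.mul (isBigO_refl (fun m => (D.cycles m : ℝ)) _)).congr_left
        fun m => ?_)).congr' ?_ .rfl)
    · filter_upwards [hpos, hlength.eventually_gt_atTop 0] with m hm hn
      positivity
    · exact show (D.decoder m).area * (D.cycles m : ℝ) * D.cycles m = _ by ring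
    · filter_upwards [hpos] with m hm
      rw [mul_assoc, Real.mul_self_sqrt hm.le]

theorem DecodingScheme.IsSchemeFor.exp_neg_mul_log {D : DecodingScheme} {ε t : ℝ}
    (h : D.IsSchemeFor ε fun n => 1 / (n : ℝ) ^ t) :
    D.IsSchemeFor ε fun n => Real.exp (-(t * Real.log n)) := by
  filter_upwards [h, D.blockLength_strictMono.tendsto_atTop.eventually_gt_atTop 0] with m hm hn
  rwa [Real.exp_neg, mul_comm, ← Real.rpow_def_of_pos (Nat.cast_pos.2 hn), ← one_div]

theorem mainTheorem5 (ε : ℝ) (hε_pos : 0 < ε) (hε_lt : ε < 1) (D : DecodingScheme)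
    (hD : D.IsPolynomiallyLowError ε) :
    ((fun m => (D.blockLength m : ℝ) * √(Real.log (D.blockLength m))) =O[atTop] D.energy) ∧
    (D.energy =Θ[atTop] (fun m => (D.blockLength m : ℝ) * √(Real.log (D.blockLength m))) →
      (fun m => √(Real.log (D.blockLength m))) =O[atTop] (fun m => (D.cycles m : ℝ))) := by
  obtain ⟨⟨t, ht, herr⟩, R, hR, hrate⟩ := hD
  have hlog : Tendsto (fun n : ℕ => Real.log n) atTop atTop :=
    Real.tendsto_log_atTop.comp tendsto_natCast_atTop_atTop
  have h := mainTheorem5_general hε_pos hε_lt hlog ht herr.exp_neg_mul_log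
    (isTheta_of_div_tendsto_nhds_ne_zero hrate hR.ne').isBigO
  exact ⟨h.1, fun hΘ => h.2 hΘ.1⟩
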